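/- **Theorem (Decidability of satisfiability).** Let $\mathcal{AP}$ be a countable set of atomic propositions. A *weighted transition system* is a triple $\mathcal M=(S,\to,\ell)$ with $S$ an arbitrary non-empty set, $\to\;\subseteq S\times\mathbb R_{\ge 0}\times S$ and $\ell:S\to 2^{\mathcal{AP}}$. For $s\in S$ and $T\subseteq S$ put $\theta(s)(T)=\{r\in\mathbb R_{\ge0}\mid s\xrightarrow{r}t\text{ for some }t\in T\}$, let $\theta^-(s)(T)=\inf\theta(s)(T)$ and $\theta^+(s)(T)=\sup\theta(s)(T)$ if $\theta(s)(T)\neq\emptyset$, and $\theta^-(s)(T)=-\infty$, $\theta^+(s)(T)=\infty$ if $\theta(s)(T)=\emptyset$. Formulas are given by $$\varphi,\psi ::= p\mid\neg\varphi\mid\varphi\wedge\psi\mid L_r\varphi\mid M_r\varphi\qquad(p\in\mathcal{AP},\ r\in\mathbb Q_{\ge0}),$$ where $\mathcal M,s\models p$ iff $p\in\ell(s)$, negation and conjunction are interpreted as usual, and, with $[\![\varphi]\!]=\{t\in S\mid\mathcal M,t\models\varphi\}$, $\mathcal M,s\models L_r\varphi$ iff $\theta^-(s)([\![\varphi]\!])\ge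 r$, and $\mathcal M,s\models M_r\varphi$ iff $\theta^+(s)([\![\varphi]\!])\le r$. A formula is *satisfiable* if it holds at some state of some weighted transition system. The satisfiability problem for this logic is decidable: for every injective numbering of $\mathcal{AP}$ by natural numbers there is an algorithm which, given (the Gödel number of) a formula $\varphi$, halts and decides whether $\varphi$ is satisfiable. -/

import Mathlib

open scoped NNReal

universe u v

/-- A weighted transition system over the atomic propositions `AP`, with an arbitrary non-empty
state space. -/
structure WTS (AP : Type u) where
  State : Type v
  nonempty : Nonempty State
  trans : State → ℝ≥0 → State → Prop
  label : State → Set AP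

namespace WTS

variable {AP : Type u}

/-- The set of all weights of transitions from `s` to a state in `T`. -/
def image (M : WTS.{u, v} AP) (s : M.State) (T : Set M.State) : Set ℝ≥0 :=
  {r | ∃ t ∈ T, M.trans s r t}

open Classical in
/-- The infimum of the weights from `s` to `T`, and `-∞` if there are none. -/
noncomputable def inf (M : WTS.{u, v} AP) (s : M.State) (T : Set M.State) : EReal :=
  if M.image s T = ∅ then ⊥ else sInf ((fun r : ℝ≥0 => ((r : ℝ) : EReal)) '' M.image s T)

open Classical in
/-- The supremum of the weights from `s` to `T`, and `∞` if there are none. -/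
noncomputable def sup (M : WTS.{u, v} AP) (s : M.State) (T : Set M.State) : EReal :=
  if M.image s T = ∅ then ⊤ else sSup ((fun r : ℝ≥0 => ((r : ℝ) : EReal)) '' M.image s T)

end WTS

/-- Formulas `p | ¬ φ | φ ∧ ψ | L_r φ | M_r φ` with `r` a non-negative rational. -/
inductive Formula (AP : Type u) : Type u
  | atom : AP → Formula AP
  | neg : Formula AP → Formula AP
  | conj : Formula AP → Formula AP → Formula AP
  | L : ℚ≥0 → Formula AP → Formula AP
  | M : ℚ≥0 → Formula AP → Formula AP

namespace Formula

variable {AP : Type u}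

/-- `φ.Holds 𝓜 s` is the satisfaction relation `𝓜, s ⊨ φ`. -/
def Holds (𝓜 : WTS.{u, v} AP) : Formula AP → 𝓜.State → Prop
  | atom p, s => p ∈ 𝓜.label s
  | neg φ, s => ¬ Holds 𝓜 φ s
  | conj φ ψ, s => Holds 𝓜 φ s ∧ Holds 𝓜 ψ s
  | L r φ, s => ((r : ℝ) : EReal) ≤ 𝓜.inf s {t | Holds 𝓜 φ t}
  | M r φ, s => 𝓜.sup s {t | Holds 𝓜 φ t} ≤ ((r : ℝ) : EReal)

/-- A formula is satisfiable if it holds at some state of some weighted transition system. -/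
def Satisfiable (φ : Formula AP) : Prop :=
  ∃ (𝓜 : WTS.{u, v} AP) (s : 𝓜.State), φ.Holds 𝓜 s

/-- The Gödel number of a formula, given a numbering `ι` of the atomic propositions. A rational
weight is written as the pair of its numerator and its denominator in lowest terms. -/
def code (ι : AP → ℕ) : Formula AP → ℕ
  | atom p => Nat.pair 0 (ι p)
  | neg φ => Nat.pair 1 (code ι φ)
  | conj φ ψ => Nat.pair 2 (Nat.pair (code ι φ) (code ι ψ))
  | L r φ => Nat.pair 3 (Nat.pair (Nat.pair r.num r.den) (code ι φ))
  | M r φ => Nat.pair 4 (Nat.pair (Nat.pair r.num r.den) (code ι φ))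

/-- Distinct formulas have distinct Gödel numbers. -/
theorem code_injective {ι : AP → ℕ} (hι : Function.Injective ι) :
    Function.Injective (code ι) := by
  intro φ
  induction φ with
  | atom p =>
    intro χ h
    cases χ <;> simp [code, Nat.pair_eq_pair] at h ⊢
    exact hι h
  | neg φ ih =>
    intro χ h
    cases χ <;> simp [code, Nat.pair_eq_pair] at h ⊢
    exact ih h
  | conj φ ψ ih1 ih2 =>
    intro χ h
    cases χ <;> simp [code, Nat.pair_eq_pair] at h ⊢
    exact ⟨ih1 h.1, ih2 h.2⟩
  | L r φ ih =>
    intro χ h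
    cases χ <;> simp [code, Nat.pair_eq_pair] at h ⊢
    exact ⟨NNRat.ext_num_den h.1.1 h.1.2, ih h.2⟩
  | M r φ ih =>
    intro χ h
    cases χ <;> simp [code, Nat.pair_eq_pair] at h ⊢
    exact ⟨NNRat.ext_num_den h.1.1 h.1.2, ih h.2⟩

end Formula

/-! ### Primitive recursive predicates -/

/-! The logic has a finite model property with a computable bound. Let `n` be the code of a formula.
Every subformula, numerator and denominator in it is at most `n`, so two reductions lose nothing.

Filtration: states are identified when they satisfy the same codes up to `n`, and one class has a
transition to another as soon as some representatives do. This suffices because `L_r` and `M_r`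
quantify over all transitions into a formula, and their truth value is recorded in the class.

Discretisation (`exists_discrete_weight`): only comparisons of weights with fractions `a / b`, `a, b
≤ n`, matter, so finitely many weights suffice.

The resulting finite systems are coded by numbers, and `Realizable` is a bounded search, hence
primitive recursive. `holds_toWTS_iff` turns a successful search into a model;
`realizable_of_codeHolds` filters an arbitrary model into a successful search. -/

theorem PrimrecPred.exists_lt_of_primrec {α : Type*} [Primcodable α] {f : α → ℕ}
    {p : ℕ → α → Prop} (hf : Primrec f) (hp : PrimrecPred fun z : ℕ × α => p z.1 z.2) :
    PrimrecPred fun a => ∃ x < f a, p x a :=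
  ((PrimrecRel.exists_mem_list (R := p) hp).comp (Primrec.list_range.comp hf) Primrec.id).of_eq fun _ => by
    simp only [List.mem_range, id]

theorem PrimrecPred.forall_lt_of_primrec {α : Type*} [Primcodable α] {f : α → ℕ}
    {p : ℕ → α → Prop} (hf : Primrec f) (hp : PrimrecPred fun z : ℕ × α => p z.1 z.2) :
    PrimrecPred fun a => ∀ x < f a, p x a :=
  ((PrimrecRel.forall_mem_list (R := p) hp).comp (Primrec.list_range.comp hf) Primrec.id).of_eq fun _ => by
    simp only [List.mem_range, id]

theorem PrimrecPred.imp {α : Type*} [Primcodable α] {p q : α → Prop} (hp : PrimrecPred p)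
    (hq : PrimrecPred q) : PrimrecPred fun a => p a → q a :=
  (hp.not.or hq).of_eq fun _ => imp_iff_not_or.symm

theorem PrimrecPred.iff {α : Type*} [Primcodable α] {p q : α → Prop} (hp : PrimrecPred p)
    (hq : PrimrecPred q) : PrimrecPred fun a => (p a ↔ q a) :=
  ((hp.imp hq).and (hq.imp hp)).of_eq fun _ => iff_iff_implies_and_implies.symm

theorem Primrec.two_pow : Primrec fun n : ℕ => 2 ^ n :=
  (Primrec.nat_rec₁ 1 (f := fun _ m => 2 * m)
    (Primrec.nat_mul.comp (Primrec.const 2) Primrec.snd)).of_eq fun n => by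
      induction n with
      | zero => rfl
      | succ n ih => rw [pow_succ, ← ih, mul_comm]

theorem Primrec.factorial : Primrec Nat.factorial :=
  (Primrec.nat_rec₁ 1 (f := fun k m => (k + 1) * m)
    (Primrec.nat_mul.comp (Primrec.succ.comp Primrec.fst) Primrec.snd)).of_eq fun n => by
      induction n with
      | zero => rfl
      | succ n ih => simp only [ih, Nat.factorial_succ]

theorem PrimrecPred.testBit {α : Type*} [Primcodable α] {f g : α → ℕ} (hf : Primrec f)
    (hg : Primrec g) : PrimrecPred fun a => (f a).testBit (g a) = true :=
  (Primrec.eq.comp (Primrec.nat_mod.comp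
    (Primrec.nat_div.comp hf (Primrec.two_pow.comp hg)) (Primrec.const 2))
    (Primrec.const 1)).of_eq fun a => by
      simp [Nat.testBit_eq_decide_div_mod_eq]

/-- Every set of numbers below `B` is the set of binary digits of some number. -/
theorem exists_testBit_iff (B : ℕ) (P : ℕ → Prop) :
    ∃ m < 2 ^ B, ∀ i, m.testBit i = true ↔ i < B ∧ P i := by
  classical
  refine ⟨Nat.ofBits fun i : Fin B => decide (P i), Nat.ofBits_lt_two_pow _, fun i => ?_⟩
  rw [Nat.testBit_ofBits]
  by_cases h : i < B <;> simp [h]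

theorem Nat.unpair_snd_lt {c : ℕ} (h : c.unpair.1 ≠ 0) : c.unpair.2 < c := by
  have := Nat.unpair_add_le c
  omega

/-! ### Discretisation of weights -/

/-- The weight `j` of a discretised system stands for `j / weightScale n`. -/
def weightScale (n : ℕ) : ℕ := 2 * n.factorial

/-- Discrete weights represent values from 0 up to and including `n + 1`, the last standing for all
weights above `n`. -/
def weightBound (n : ℕ) : ℕ := weightScale n * (n + 1) + 1

theorem weightScale_pos (n : ℕ) : 0 < weightScale n :=
  Nat.mul_pos two_pos n.factorial_pos

theorem exists_discrete_weight (n : ℕ) (w : ℝ≥0) :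
    ∃ j < weightBound n, ∀ a ≤ n, ∀ b ≤ n,
      ((a : ℝ) ≤ w * b ↔ a * weightScale n ≤ j * b) ∧
      ((w : ℝ) * b ≤ a ↔ j * b ≤ a * weightScale n) := by
  have hw0 : (0 : ℝ) ≤ w := w.2
  rcases le_or_gt (w : ℝ) n with hw | hw
  · set x : ℝ := w * n.factorial with hx
    have hx0 : 0 ≤ x := by positivity
    have hcf : ⌈x⌉₊ ≤ ⌊x⌋₊ + 1 := Nat.ceil_le_floor_add_one x
    have hfc : ⌊x⌋₊ ≤ ⌈x⌉₊ := Nat.floor_le_ceil x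
    have hcn : ⌈x⌉₊ ≤ n * n.factorial := by
      refine Nat.ceil_le.2 ?_
      push_cast
      exact mul_le_mul_of_nonneg_right hw (by positivity)
    -- Multiplied by `n!`, every threshold `a / b` with `b > 0` is an integer. The witness is `2 *
    -- k` if `x = k` and `2 * k + 1` if `k < x < k + 1`: even values are possible thresholds, odd
    -- ones the open gaps between them. This is the factor 2 in `weightScale`.
    refine ⟨⌊x⌋₊ + ⌈x⌉₊, ?_, fun a _ b hb => ?_⟩
    · have := n.factorial_pos
      simp only [weightBound, weightScale]
      nlinarith
    · rcases Nat.eq_zero_or_pos b with rfl | hb0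
      · have := weightScale_pos n
        constructor <;> simp
        omega
      · obtain ⟨e, he⟩ := Nat.dvd_factorial hb0 hb
        have he0 : 0 < e := Nat.pos_of_ne_zero fun h => n.factorial_ne_zero (by simp [he, h])
        have hxe : x = w * b * e := by rw [hx, he]; push_cast; ring
        have he0' : (0 : ℝ) < e := by exact_mod_cast he0
        have hs : a * weightScale n = 2 * (a * e) * b := by rw [weightScale, he]; ring
        rw [hs, Nat.mul_le_mul_right_iff hb0, Nat.mul_le_mul_right_iff hb0]
        constructor
        · have : (a : ℝ) ≤ w * b ↔ a * e ≤ ⌊x⌋₊ := by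
            rw [Nat.le_floor_iff hx0, hxe]
            push_cast
            exact (mul_le_mul_iff_left₀ he0').symm
          rw [this]
          omega
        · have : (w : ℝ) * b ≤ a ↔ ⌈x⌉₊ ≤ a * e := by
            rw [Nat.ceil_le, hxe]
            push_cast
            exact (mul_le_mul_iff_left₀ he0').symm
          rw [this]
          omega
  · refine ⟨weightScale n * (n + 1), Nat.lt_succ_self _, fun a ha b _ => ?_⟩
    have hpos := weightScale_pos n
    rcases Nat.eq_zero_or_pos b with rfl | hb0
    · constructor <;> simp
      omega
    · have h1 : (a : ℝ) < w * b := by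
        have h2 : (a : ℝ) ≤ n := by exact_mod_cast ha
        have h3 : (1 : ℝ) ≤ b := by exact_mod_cast hb0
        nlinarith
      have h2 : a * weightScale n < weightScale n * (n + 1) * b := by
        calc a * weightScale n < (n + 1) * weightScale n :=
              Nat.mul_lt_mul_of_pos_right (by omega) hpos
          _ = weightScale n * (n + 1) * 1 := by ring
          _ ≤ _ := Nat.mul_le_mul_left _ hb0
      exact ⟨iff_of_true h1.le h2.le, iff_of_false h1.not_ge h2.not_ge⟩

/-! ### Satisfaction in terms of transitions -/

theorem NNRat.cast_le_iff_num_le (r : ℚ≥0) (w : ℝ) : (r : ℝ) ≤ w ↔ (r.num : ℝ) ≤ w * r.den := by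
  have h : (0 : ℝ) < r.den := by exact_mod_cast r.den_pos
  rw [NNRat.cast_def, div_le_iff₀ h]

theorem NNRat.le_cast_iff_le_num (r : ℚ≥0) (w : ℝ) : w ≤ (r : ℝ) ↔ w * r.den ≤ (r.num : ℝ) := by
  have h : (0 : ℝ) < r.den := by exact_mod_cast r.den_pos
  rw [NNRat.cast_def, le_div_iff₀ h]

namespace Formula

variable {AP : Type u} {𝓜 : WTS.{u, v} AP}

/-- The default value `-∞` makes `L_r φ` false when no transition leads into `φ`, whence the
existential conjunct. For `M_r φ` the default `∞` has the same effect. -/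
theorem holds_L_iff (r : ℚ≥0) (φ : Formula AP) (s : 𝓜.State) :
    (L r φ).Holds 𝓜 s ↔ (∃ w t, 𝓜.trans s w t ∧ φ.Holds 𝓜 t) ∧
      ∀ w t, 𝓜.trans s w t → φ.Holds 𝓜 t → (r.num : ℝ) ≤ w * r.den := by
  simp only [Holds, WTS.inf, ← NNRat.cast_le_iff_num_le]
  split_ifs with h
  · refine iff_of_false (by simp) fun ⟨⟨w, t, ht, hφ⟩, _⟩ => ?_
    exact (h ▸ (⟨t, hφ, ht⟩ : w ∈ 𝓜.image s {t | φ.Holds 𝓜 t}) : w ∈ (∅ : Set ℝ≥0))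
  · obtain ⟨w, t, hφ, ht⟩ := Set.nonempty_iff_ne_empty.2 h
    simp only [le_sInf_iff, Set.forall_mem_image, EReal.coe_le_coe_iff]
    exact ⟨fun H => ⟨⟨w, t, ht, hφ⟩, fun w t ht hφ => H ⟨t, hφ, ht⟩⟩,
      fun H w ⟨t, hφ, ht⟩ => H.2 w t ht hφ⟩

theorem holds_M_iff (r : ℚ≥0) (φ : Formula AP) (s : 𝓜.State) :
    (M r φ).Holds 𝓜 s ↔ (∃ w t, 𝓜.trans s w t ∧ φ.Holds 𝓜 t) ∧
      ∀ w t, 𝓜.trans s w t → φ.Holds 𝓜 t → (w : ℝ) * r.den ≤ r.num := by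
  simp only [Holds, WTS.sup, ← NNRat.le_cast_iff_le_num]
  split_ifs with h
  · refine iff_of_false (by simp) fun ⟨⟨w, t, ht, hφ⟩, _⟩ => ?_
    exact (h ▸ (⟨t, hφ, ht⟩ : w ∈ 𝓜.image s {t | φ.Holds 𝓜 t}) : w ∈ (∅ : Set ℝ≥0))
  · obtain ⟨w, t, hφ, ht⟩ := Set.nonempty_iff_ne_empty.2 h
    simp only [sSup_le_iff, Set.forall_mem_image, EReal.coe_le_coe_iff]
    exact ⟨fun H => ⟨⟨w, t, ht, hφ⟩, fun w t ht hφ => H ⟨t, hφ, ht⟩⟩,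
      fun H w ⟨t, hφ, ht⟩ => H.2 w t ht hφ⟩

end Formula

/-! ### Discretised systems

A state is the number whose binary digits are the codes of the formulas that hold there. A number
`A` encodes a set of states, and a number `T` a set of transitions between states. -/

namespace DiscreteSystem

/-- A state is a subset of the codes `0, …, n`. -/
def stateBound (n : ℕ) : ℕ := 2 ^ (n + 1)

def transBound (n : ℕ) : ℕ := Nat.pair (stateBound n) (Nat.pair (weightBound n) (stateBound n))

theorem pair_lt_transBound {n s j t : ℕ} (hs : s < stateBound n) (hj : j < weightBound n)
    (ht : t < stateBound n) : Nat.pair s (Nat.pair j t) < transBound n :=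
  (Nat.pair_lt_pair_left _ hs).trans <| Nat.pair_lt_pair_right _ <|
    (Nat.pair_lt_pair_left _ hj).trans <| Nat.pair_lt_pair_right _ ht

/-- There is a transition of weight `j` from `s` to the state `t`, where the formula with code `d`
holds. -/
def Step (A T s d j t : ℕ) : Prop :=
  A.testBit t = true ∧ T.testBit (Nat.pair s (Nat.pair j t)) = true ∧ t.testBit d = true

def HasStep (n A T s d : ℕ) : Prop :=
  ∃ j < weightBound n, ∃ t < stateBound n, Step A T s d j t

/-- All weights of steps are at least `q.1 / q.2`. -/
def StepsGe (n A T s d : ℕ) (q : ℕ × ℕ) : Prop :=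
  ∀ j < weightBound n, ∀ t < stateBound n, Step A T s d j t → q.1 * weightScale n ≤ j * q.2

/-- All weights of steps are at most `q.1 / q.2`. -/
def StepsLe (n A T s d : ℕ) (q : ℕ × ℕ) : Prop :=
  ∀ j < weightBound n, ∀ t < stateBound n, Step A T s d j t → j * q.2 ≤ q.1 * weightScale n

/-- The state `s` makes the formula with code `c` true exactly if the clause of its main connective
says so. -/
def Coherent (n A T s c : ℕ) : Prop :=
  (c.unpair.1 = 1 → (s.testBit c = true ↔ ¬ s.testBit c.unpair.2 = true)) ∧
  (c.unpair.1 = 2 → (s.testBit c = true ↔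
    s.testBit c.unpair.2.unpair.1 = true ∧ s.testBit c.unpair.2.unpair.2 = true)) ∧
  (c.unpair.1 = 3 → (s.testBit c = true ↔ HasStep n A T s c.unpair.2.unpair.2 ∧
    StepsGe n A T s c.unpair.2.unpair.2 c.unpair.2.unpair.1.unpair)) ∧
  (c.unpair.1 = 4 → (s.testBit c = true ↔ HasStep n A T s c.unpair.2.unpair.2 ∧
    StepsLe n A T s c.unpair.2.unpair.2 c.unpair.2.unpair.1.unpair))

def IsCoherent (n A T : ℕ) : Prop :=
  ∀ s < stateBound n, A.testBit s = true → ∀ c < n + 1, Coherent n A T s c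

/-- Some coherent discretised system has a state where the formula with code `n` holds. -/
def Realizable (n : ℕ) : Prop :=
  ∃ A < 2 ^ stateBound n, ∃ T < 2 ^ transBound n, IsCoherent n A T ∧
    ∃ s < stateBound n, A.testBit s = true ∧ s.testBit n = true

/-! ### Computability -/

open Primrec

theorem primrec_weightScale : Primrec weightScale :=
  nat_mul.comp (const 2) Primrec.factorial

theorem primrec_weightBound : Primrec weightBound :=
  succ.comp (nat_mul.comp primrec_weightScale succ)

theorem primrec_stateBound : Primrec stateBound :=
  two_pow.comp succ

theorem primrec_transBound : Primrec transBound :=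
  Primrec₂.natPair.comp primrec_stateBound
    (Primrec₂.natPair.comp primrec_weightBound primrec_stateBound)

section

variable {α : Type*} [Primcodable α] {n A T s c d j t : α → ℕ} {q : α → ℕ × ℕ}

theorem primrecPred_step (hA : Primrec A) (hT : Primrec T) (hs : Primrec s) (hd : Primrec d)
    (hj : Primrec j) (ht : Primrec t) :
    PrimrecPred fun a => Step (A a) (T a) (s a) (d a) (j a) (t a) :=
  (PrimrecPred.testBit hA ht).and ((PrimrecPred.testBit hT
    (Primrec₂.natPair.comp hs (Primrec₂.natPair.comp hj ht))).and (PrimrecPred.testBit ht hd))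

theorem primrecPred_step_two_binders (hA : Primrec A) (hT : Primrec T) (hs : Primrec s)
    (hd : Primrec d) :
    PrimrecPred fun z : ℕ × ℕ × α => Step (A z.2.2) (T z.2.2) (s z.2.2) (d z.2.2) z.2.1 z.1 :=
  have h : Primrec fun z : ℕ × ℕ × α => z.2.2 := snd.comp snd
  primrecPred_step (hA.comp h) (hT.comp h) (hs.comp h) (hd.comp h) (fst.comp snd) fst

theorem primrecPred_hasStep (hn : Primrec n) (hA : Primrec A) (hT : Primrec T) (hs : Primrec s)
    (hd : Primrec d) : PrimrecPred fun a => HasStep (n a) (A a) (T a) (s a) (d a) :=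
  PrimrecPred.exists_lt_of_primrec (primrec_weightBound.comp hn) <|
    PrimrecPred.exists_lt_of_primrec (p := fun t (z : ℕ × α) =>
      Step (A z.2) (T z.2) (s z.2) (d z.2) z.1 t) (primrec_stateBound.comp (hn.comp snd)) <|
      primrecPred_step_two_binders hA hT hs hd

theorem primrecPred_stepsGe (hn : Primrec n) (hA : Primrec A) (hT : Primrec T) (hs : Primrec s)
    (hd : Primrec d) (hq : Primrec q) :
    PrimrecPred fun a => StepsGe (n a) (A a) (T a) (s a) (d a) (q a) :=
  PrimrecPred.forall_lt_of_primrec (primrec_weightBound.comp hn) <|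
    PrimrecPred.forall_lt_of_primrec (p := fun t (z : ℕ × α) =>
      Step (A z.2) (T z.2) (s z.2) (d z.2) z.1 t →
        (q z.2).1 * weightScale (n z.2) ≤ z.1 * (q z.2).2)
      (primrec_stateBound.comp (hn.comp snd)) <|
      have h : Primrec fun z : ℕ × ℕ × α => z.2.2 := snd.comp snd
      (primrecPred_step_two_binders hA hT hs hd).imp <| nat_le.comp
        (nat_mul.comp (fst.comp (hq.comp h)) (primrec_weightScale.comp (hn.comp h)))
        (nat_mul.comp (fst.comp snd) (snd.comp (hq.comp h)))

theorem primrecPred_stepsLe (hn : Primrec n) (hA : Primrec A) (hT : Primrec T) (hs : Primrec s)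
    (hd : Primrec d) (hq : Primrec q) :
    PrimrecPred fun a => StepsLe (n a) (A a) (T a) (s a) (d a) (q a) :=
  PrimrecPred.forall_lt_of_primrec (primrec_weightBound.comp hn) <|
    PrimrecPred.forall_lt_of_primrec (p := fun t (z : ℕ × α) =>
      Step (A z.2) (T z.2) (s z.2) (d z.2) z.1 t →
        z.1 * (q z.2).2 ≤ (q z.2).1 * weightScale (n z.2))
      (primrec_stateBound.comp (hn.comp snd)) <|
      have h : Primrec fun z : ℕ × ℕ × α => z.2.2 := snd.comp snd
      (primrecPred_step_two_binders hA hT hs hd).imp <| nat_le.comp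
        (nat_mul.comp (fst.comp snd) (snd.comp (hq.comp h)))
        (nat_mul.comp (fst.comp (hq.comp h)) (primrec_weightScale.comp (hn.comp h)))

theorem primrecPred_coherent (hn : Primrec n) (hA : Primrec A) (hT : Primrec T) (hs : Primrec s)
    (hc : Primrec c) : PrimrecPred fun a => Coherent (n a) (A a) (T a) (s a) (c a) := by
  have hu := unpair.comp hc
  have hk (k : ℕ) : PrimrecPred fun a => (c a).unpair.1 = k :=
    Primrec.eq.comp (fst.comp hu) (const k)
  have h2 := snd.comp hu
  have hu2 := unpair.comp h2
  have hq := unpair.comp (fst.comp hu2)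
  have hd := snd.comp hu2
  have hb := PrimrecPred.testBit hs hc
  have hstep := primrecPred_hasStep hn hA hT hs hd
  exact ((hk 1).imp (hb.iff (PrimrecPred.testBit hs h2).not)).and <|
    ((hk 2).imp (hb.iff ((PrimrecPred.testBit hs (fst.comp hu2)).and
      (PrimrecPred.testBit hs hd)))).and <|
    ((hk 3).imp (hb.iff (hstep.and (primrecPred_stepsGe hn hA hT hs hd hq)))).and
    ((hk 4).imp (hb.iff (hstep.and (primrecPred_stepsLe hn hA hT hs hd hq))))

theorem primrecPred_isCoherent (hn : Primrec n) (hA : Primrec A) (hT : Primrec T) :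
    PrimrecPred fun a => IsCoherent (n a) (A a) (T a) :=
  PrimrecPred.forall_lt_of_primrec
    (p := fun s a => (A a).testBit s = true → ∀ c < n a + 1, Coherent (n a) (A a) (T a) s c)
    (primrec_stateBound.comp hn) <|
    (PrimrecPred.testBit (hA.comp snd) fst).imp <|
    PrimrecPred.forall_lt_of_primrec
      (p := fun c (z : ℕ × α) => Coherent (n z.2) (A z.2) (T z.2) z.1 c)
      (succ.comp (hn.comp snd)) <|
      have h : Primrec fun z : ℕ × ℕ × α => z.2.2 := snd.comp snd
      primrecPred_coherent (hn.comp h) (hA.comp h) (hT.comp h) (fst.comp snd) fst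

end

theorem primrecPred_realizable : PrimrecPred Realizable :=
  PrimrecPred.exists_lt_of_primrec
    (p := fun A n => ∃ T < 2 ^ transBound n, IsCoherent n A T ∧
      ∃ s < stateBound n, A.testBit s = true ∧ s.testBit n = true)
    (two_pow.comp primrec_stateBound) <|
    PrimrecPred.exists_lt_of_primrec
      (p := fun T (z : ℕ × ℕ) => IsCoherent z.2 z.1 T ∧
        ∃ s < stateBound z.2, z.1.testBit s = true ∧ s.testBit z.2 = true)
      (two_pow.comp (primrec_transBound.comp snd)) <|
      have h1 : Primrec fun z : ℕ × ℕ × ℕ => z.2.1 := fst.comp snd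
      have h2 : Primrec fun z : ℕ × ℕ × ℕ => z.2.2 := snd.comp snd
      (primrecPred_isCoherent h2 h1 fst).and <|
        PrimrecPred.exists_lt_of_primrec
          (p := fun s (z : ℕ × ℕ × ℕ) => z.2.1.testBit s = true ∧ s.testBit z.2.2 = true)
          (primrec_stateBound.comp h2) <|
          (PrimrecPred.testBit (h1.comp snd) fst).and (PrimrecPred.testBit fst (h2.comp snd))

/-! ### Soundness -/

section Soundness

variable {AP : Type u}

/-- The weighted transition system encoded by `A` and `T`. -/
noncomputable def toWTS (ι : AP → ℕ) (n A T s₀ : ℕ) (h₀ : s₀ < stateBound n ∧ A.testBit s₀ = true) :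
    WTS.{u, v} AP where
  State := ULift.{v} {s : ℕ // s < stateBound n ∧ A.testBit s = true}
  nonempty := ⟨⟨⟨s₀, h₀⟩⟩⟩
  trans s w t := ∃ j < weightBound n, w = (j : ℝ≥0) / weightScale n ∧
    T.testBit (Nat.pair s.down.1 (Nat.pair j t.down.1)) = true
  label s := {p | s.down.1.testBit (Nat.pair 0 (ι p)) = true}

theorem natCast_le_div_weightScale_mul (n a b j : ℕ) :
    (a : ℝ) ≤ (((j : ℝ≥0) / weightScale n : ℝ≥0) : ℝ) * b ↔ a * weightScale n ≤ j * b := by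
  have h : (0 : ℝ) < weightScale n := by exact_mod_cast weightScale_pos n
  push_cast
  rw [div_mul_eq_mul_div, le_div_iff₀ h]
  exact_mod_cast Iff.rfl

theorem div_weightScale_mul_le_natCast (n a b j : ℕ) :
    (((j : ℝ≥0) / weightScale n : ℝ≥0) : ℝ) * b ≤ a ↔ j * b ≤ a * weightScale n := by
  have h : (0 : ℝ) < weightScale n := by exact_mod_cast weightScale_pos n
  push_cast
  rw [div_mul_eq_mul_div, div_le_iff₀ h]
  exact_mod_cast Iff.rfl

variable {ι : AP → ℕ} {n A T s₀ : ℕ} {h₀ : s₀ < stateBound n ∧ A.testBit s₀ = true}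

theorem exists_step_toWTS_iff {φ : Formula AP} {d : ℕ}
    (hφ : ∀ s : (toWTS.{u, v} ι n A T s₀ h₀).State, φ.Holds _ s ↔ s.down.1.testBit d = true)
    (s : (toWTS.{u, v} ι n A T s₀ h₀).State) :
    (∃ w t, (toWTS.{u, v} ι n A T s₀ h₀).trans s w t ∧ φ.Holds _ t) ↔
      HasStep n A T s.down.1 d := by
  constructor
  · rintro ⟨w, t, ⟨j, hj, -, hT⟩, ht⟩
    exact ⟨j, hj, t.down.1, t.down.2.1, t.down.2.2, hT, (hφ t).1 ht⟩
  · rintro ⟨j, hj, t, ht, hA, hT, hd⟩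
    exact ⟨_, ⟨⟨t, ht, hA⟩⟩, ⟨j, hj, rfl, hT⟩, (hφ _).2 hd⟩

theorem forall_step_toWTS_iff {φ : Formula AP} {d : ℕ}
    (hφ : ∀ s : (toWTS.{u, v} ι n A T s₀ h₀).State, φ.Holds _ s ↔ s.down.1.testBit d = true)
    (s : (toWTS.{u, v} ι n A T s₀ h₀).State) (P : ℝ≥0 → Prop) :
    (∀ w t, (toWTS.{u, v} ι n A T s₀ h₀).trans s w t → φ.Holds _ t → P w) ↔
      ∀ j < weightBound n, ∀ t < stateBound n, Step A T s.down.1 d j t →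
        P ((j : ℝ≥0) / weightScale n) := by
  constructor
  · intro H j hj t ht hs
    exact H _ ⟨⟨t, ht, hs.1⟩⟩ ⟨j, hj, rfl, hs.2.1⟩ ((hφ _).2 hs.2.2)
  · rintro H w t ⟨j, hj, rfl, hT⟩ ht
    exact H j hj t.down.1 t.down.2.1 ⟨t.down.2.2, hT, (hφ t).1 ht⟩

/-- Truth lemma by induction on the formula: codes of subformulas stay below `n`, so coherence
supplies the clause of each connective. Atoms need none, since the labelling is read off the digits.
-/
theorem holds_toWTS_iff (hc : IsCoherent n A T) (φ : Formula AP) :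
    φ.code ι ≤ n → ∀ s : (toWTS.{u, v} ι n A T s₀ h₀).State,
      φ.Holds _ s ↔ s.down.1.testBit (φ.code ι) = true := by
  induction φ with
  | atom p => intro _ s; exact Iff.rfl
  | neg φ ih =>
    intro h s
    have hs := (hc s.down.1 s.down.2.1 s.down.2.2 _ (Nat.lt_succ_of_le h)).1
    simp only [Formula.code, Nat.unpair_pair, true_imp_iff] at hs h
    rw [Formula.code, hs, Formula.Holds, ih ((Nat.right_le_pair _ _).trans h)]
  | conj φ ψ ih₁ ih₂ =>
    intro h s
    have hs := (hc s.down.1 s.down.2.1 s.down.2.2 _ (Nat.lt_succ_of_le h)).2.1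
    simp only [Formula.code, Nat.unpair_pair, true_imp_iff] at hs h
    have h' := (Nat.right_le_pair _ _).trans h
    rw [Formula.code, hs, Formula.Holds, ih₁ ((Nat.left_le_pair _ _).trans h'),
      ih₂ ((Nat.right_le_pair _ _).trans h')]
  | L r φ ih =>
    intro h s
    have hs := (hc s.down.1 s.down.2.1 s.down.2.2 _ (Nat.lt_succ_of_le h)).2.2.1
    simp only [Formula.code, Nat.unpair_pair, true_imp_iff] at hs h
    have ih := ih ((Nat.right_le_pair _ _).trans ((Nat.right_le_pair _ _).trans h))
    rw [Formula.code, hs, Formula.holds_L_iff, exists_step_toWTS_iff ih,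
      forall_step_toWTS_iff ih s fun w => (r.num : ℝ) ≤ w * r.den]
    simp only [natCast_le_div_weightScale_mul, StepsGe]
  | M r φ ih =>
    intro h s
    have hs := (hc s.down.1 s.down.2.1 s.down.2.2 _ (Nat.lt_succ_of_le h)).2.2.2
    simp only [Formula.code, Nat.unpair_pair, true_imp_iff] at hs h
    have ih := ih ((Nat.right_le_pair _ _).trans ((Nat.right_le_pair _ _).trans h))
    rw [Formula.code, hs, Formula.holds_M_iff, exists_step_toWTS_iff ih,
      forall_step_toWTS_iff ih s fun w => (w : ℝ) * r.den ≤ r.num]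
    simp only [div_weightScale_mul_le_natCast, StepsLe]

theorem satisfiable_of_realizable {φ : Formula AP} (h : Realizable (φ.code ι)) :
    Formula.Satisfiable.{u, v} φ := by
  obtain ⟨A, -, T, -, hc, s, hs, hA, hφ⟩ := h
  exact ⟨toWTS ι _ A T s ⟨hs, hA⟩, ⟨⟨s, hs, hA⟩⟩, (holds_toWTS_iff hc φ le_rfl _).2 hφ⟩

end Soundness

/-! ### Completeness -/

section Completeness

variable {AP : Type u}

/-- Satisfaction extended to all natural numbers, read as codes of formulas. -/
def CodeHolds (ι : AP → ℕ) (𝓜 : WTS.{u, v} AP) (c : ℕ) (s : 𝓜.State) : Prop :=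
  if h : c.unpair.1 = 0 then ∃ p ∈ 𝓜.label s, ι p = c.unpair.2
  else
    have h₁ : c.unpair.2 < c := Nat.unpair_snd_lt h
    have : c.unpair.2.unpair.1 < c := (Nat.unpair_left_le _).trans_lt h₁
    have : c.unpair.2.unpair.2 < c := (Nat.unpair_right_le _).trans_lt h₁
    if c.unpair.1 = 1 then ¬ CodeHolds ι 𝓜 c.unpair.2 s
    else if c.unpair.1 = 2 then
      CodeHolds ι 𝓜 c.unpair.2.unpair.1 s ∧ CodeHolds ι 𝓜 c.unpair.2.unpair.2 s
    else if c.unpair.1 = 3 then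
      (∃ w t, 𝓜.trans s w t ∧ CodeHolds ι 𝓜 c.unpair.2.unpair.2 t) ∧
        ∀ w t, 𝓜.trans s w t → CodeHolds ι 𝓜 c.unpair.2.unpair.2 t →
          (c.unpair.2.unpair.1.unpair.1 : ℝ) ≤ w * c.unpair.2.unpair.1.unpair.2
    else if c.unpair.1 = 4 then
      (∃ w t, 𝓜.trans s w t ∧ CodeHolds ι 𝓜 c.unpair.2.unpair.2 t) ∧
        ∀ w t, 𝓜.trans s w t → CodeHolds ι 𝓜 c.unpair.2.unpair.2 t →
          (w : ℝ) * c.unpair.2.unpair.1.unpair.2 ≤ c.unpair.2.unpair.1.unpair.1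
    -- Any value would do here: coherence does not constrain tags above 4.
    else False
termination_by c

variable {ι : AP → ℕ} {𝓜 : WTS.{u, v} AP}

theorem codeHolds_iff_of_three {c : ℕ} (h : c.unpair.1 = 3) (s : 𝓜.State) :
    CodeHolds ι 𝓜 c s ↔ (∃ w t, 𝓜.trans s w t ∧ CodeHolds ι 𝓜 c.unpair.2.unpair.2 t) ∧
      ∀ w t, 𝓜.trans s w t → CodeHolds ι 𝓜 c.unpair.2.unpair.2 t →
        (c.unpair.2.unpair.1.unpair.1 : ℝ) ≤ w * c.unpair.2.unpair.1.unpair.2 := by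
  rw [CodeHolds]
  simp [h]

theorem codeHolds_iff_of_four {c : ℕ} (h : c.unpair.1 = 4) (s : 𝓜.State) :
    CodeHolds ι 𝓜 c s ↔ (∃ w t, 𝓜.trans s w t ∧ CodeHolds ι 𝓜 c.unpair.2.unpair.2 t) ∧
      ∀ w t, 𝓜.trans s w t → CodeHolds ι 𝓜 c.unpair.2.unpair.2 t →
        (w : ℝ) * c.unpair.2.unpair.1.unpair.2 ≤ c.unpair.2.unpair.1.unpair.1 := by
  rw [CodeHolds]
  simp [h]

/-- Injectivity of `ι` enters in the atomic case: two atoms sharing a code could not be told apart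
by `CodeHolds`. -/
theorem codeHolds_code_iff (hι : Function.Injective ι) (φ : Formula AP) :
    ∀ s, CodeHolds ι 𝓜 (φ.code ι) s ↔ φ.Holds 𝓜 s := by
  induction φ with
  | atom p =>
    intro s
    rw [CodeHolds]
    simp [Formula.code, Formula.Holds, hι.eq_iff]
  | neg φ ih =>
    intro s
    rw [CodeHolds]
    simp [Formula.code, Formula.Holds, ih]
  | conj φ ψ ih₁ ih₂ =>
    intro s
    rw [CodeHolds]
    simp [Formula.code, Formula.Holds, ih₁, ih₂]
  | L r φ ih =>
    intro s
    rw [CodeHolds]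
    simp [Formula.code, Formula.holds_L_iff, ih]
  | M r φ ih =>
    intro s
    rw [CodeHolds]
    simp [Formula.code, Formula.holds_M_iff, ih]

/-- The filtration: `τ` sends a state to its class and `ρ` discretises weights. Working with
`CodeHolds` rather than formulas gives coherence at every number up to `n`, whether or not it codes
a formula. -/
theorem realizable_of_codeHolds {n : ℕ} {s₀ : 𝓜.State} (h₀ : CodeHolds ι 𝓜 n s₀) :
    Realizable n := by
  choose τ hτ hτb using fun s : 𝓜.State =>
    exists_testBit_iff (n + 1) fun c => CodeHolds ι 𝓜 c s
  choose ρ hρ hρw using exists_discrete_weight n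
  obtain ⟨A, hA, hAb⟩ := exists_testBit_iff (stateBound n) (· ∈ Set.range τ)
  obtain ⟨T, hT, hTb⟩ := exists_testBit_iff (transBound n) fun i =>
    ∃ s w t, 𝓜.trans s w t ∧ i = Nat.pair (τ s) (Nat.pair (ρ w) (τ t))
  have hAτ (s : 𝓜.State) : A.testBit (τ s) = true := (hAb _).2 ⟨hτ s, s, rfl⟩
  have hbit (s : 𝓜.State) {c : ℕ} (hc : c ≤ n) :
      (τ s).testBit c = true ↔ CodeHolds ι 𝓜 c s := by
    rw [hτb, and_iff_right (Nat.lt_succ_of_le hc)]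
  have hstep {s t : 𝓜.State} {w : ℝ≥0} (h : 𝓜.trans s w t) {d : ℕ} (hd : d ≤ n)
      (ht : CodeHolds ι 𝓜 d t) : Step A T (τ s) d (ρ w) (τ t) :=
    ⟨hAτ t, (hTb _).2 ⟨pair_lt_transBound (hτ s) (hρ w) (hτ t), s, w, t, h, rfl⟩,
      (hbit t hd).2 ht⟩
  have hstep' {s d j t : ℕ} (hd : d ≤ n) (h : Step A T s d j t) :
      ∃ s' w t', 𝓜.trans s' w t' ∧ CodeHolds ι 𝓜 d t' ∧ τ s' = s ∧ ρ w = j := by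
    obtain ⟨-, hT, ht⟩ := h
    obtain ⟨-, s', w, t', htr, he⟩ := (hTb _).1 hT
    simp only [Nat.pair_eq_pair] at he
    obtain ⟨rfl, rfl, rfl⟩ := he
    exact ⟨s', w, t', htr, (hbit t' hd).1 ht, rfl, rfl⟩
  -- A step out of `τ s` may come from another representative `s'`; this moves modal truths between
  -- the two.
  have hτeq {s s' : 𝓜.State} (h : τ s' = τ s) {c : ℕ} (hc : c ≤ n) :
      CodeHolds ι 𝓜 c s' ↔ CodeHolds ι 𝓜 c s := by
    rw [← hbit s hc, ← hbit s' hc, h]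
  refine ⟨A, hA, T, hT, ?_, τ s₀, hτ s₀, hAτ s₀, (hbit s₀ le_rfl).2 h₀⟩
  intro _ _ hs c hc
  obtain ⟨-, s, rfl⟩ := (hAb _).1 hs
  replace hc := Nat.le_of_lt_succ hc
  have hc2 := (Nat.unpair_right_le c).trans hc
  have hc22 := (Nat.unpair_right_le c.unpair.2).trans hc2
  have hc21 := (Nat.unpair_left_le c.unpair.2).trans hc2
  have ha := (Nat.unpair_left_le c.unpair.2.unpair.1).trans hc21
  have hb := (Nat.unpair_right_le c.unpair.2.unpair.1).trans hc21
  refine ⟨fun h => ?_, fun h => ?_, fun h => ?_, fun h => ?_⟩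
  · rw [hbit s hc, hbit s hc2, CodeHolds]
    simp [h]
  · rw [hbit s hc, hbit s hc22, hbit s hc21, CodeHolds]
    simp [h]
  · have hiff := codeHolds_iff_of_three (ι := ι) (𝓜 := 𝓜) h
    rw [hbit s hc]
    constructor
    · intro H
      obtain ⟨⟨w, t, hw, ht⟩, -⟩ := (hiff s).1 H
      refine ⟨⟨ρ w, hρ w, τ t, hτ t, hstep hw hc22 ht⟩, fun j _ t _ hst => ?_⟩
      obtain ⟨s', w, t', hw, ht, hs', rfl⟩ := hstep' hc22 hst
      exact (hρw w _ ha _ hb).1.1 (((hiff s').1 ((hτeq hs' hc).2 H)).2 w t' hw ht)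
    · rintro ⟨⟨j, hj, t, ht, hst⟩, H⟩
      by_contra hn
      obtain ⟨s', w, t', hw, ht, hs', rfl⟩ := hstep' hc22 hst
      -- The modal formula is proved at `s'`, which has an actual transition into the subformula,
      -- and then carried back to `s`. All transitions of `s'` are steps out of the common class, so
      -- `H` bounds them.
      refine hn ((hτeq hs' hc).1 ((hiff s').2 ⟨⟨w, t', hw, ht⟩, fun w t hw ht => ?_⟩))
      exact (hρw w _ ha _ hb).1.2 (H _ (hρ w) _ (hτ t) (hs' ▸ hstep hw hc22 ht))
  · have hiff := codeHolds_iff_of_four (ι := ι) (𝓜 := 𝓜) h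
    rw [hbit s hc]
    constructor
    · intro H
      obtain ⟨⟨w, t, hw, ht⟩, -⟩ := (hiff s).1 H
      refine ⟨⟨ρ w, hρ w, τ t, hτ t, hstep hw hc22 ht⟩, fun j _ t _ hst => ?_⟩
      obtain ⟨s', w, t', hw, ht, hs', rfl⟩ := hstep' hc22 hst
      exact (hρw w _ ha _ hb).2.1 (((hiff s').1 ((hτeq hs' hc).2 H)).2 w t' hw ht)
    · rintro ⟨⟨j, hj, t, ht, hst⟩, H⟩
      by_contra hn
      obtain ⟨s', w, t', hw, ht, hs', rfl⟩ := hstep' hc22 hst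
      refine hn ((hτeq hs' hc).1 ((hiff s').2 ⟨⟨w, t', hw, ht⟩, fun w t hw ht => ?_⟩))
      exact (hρw w _ ha _ hb).2.2 (H _ (hρ w) _ (hτ t) (hs' ▸ hstep hw hc22 ht))

end Completeness

end DiscreteSystem

/-- The same `D` serves every `AP` and every numbering, as `Realizable` depends on the code alone.
-/
theorem mainTheorem3 (AP : Type u) (ι : AP → ℕ) (hι : Function.Injective ι) :
    ∃ D : ℕ → Prop, ComputablePred D ∧
      ∀ φ : Formula AP, D (φ.code ι) ↔ Formula.Satisfiable.{u, v} φ :=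
  ⟨DiscreteSystem.Realizable, DiscreteSystem.primrecPred_realizable.computablePred, fun φ =>
    ⟨DiscreteSystem.satisfiable_of_realizable, fun ⟨_, s, hs⟩ =>
      DiscreteSystem.realizable_of_codeHolds ((DiscreteSystem.codeHolds_code_iff hι φ s).2 hs)⟩⟩
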